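/- Let $f:\mathbb{R}\to\mathbb{R}$ be twice differentiable with $f>0$, $f'\ge 0$, $f''>0$ on $\mathbb{R}$ and $\lim_{u\to\infty} f(u)/u=\infty$, and let $\alpha<0$, $\lambda>0$, $L>0$. Set $\gamma^*=\sqrt{\lambda}/\alpha$, let $F(u)=\int_{-\infty}^u f(t)\,dt$ if $f$ is integrable at $-\infty$ and $F(u)=\int_0^u f(t)\,dt$ otherwise, and put $s_0=F(0)$. For $C>s_0$ let $v_1^+(C)$ be the largest $v$ with $F(\gamma^* v)=C-\frac{v^2}{2}$, and let $$L_1(C)=2\int_0^{v_1^+(C)}\frac{dv}{\sqrt{\lambda}\,f\!\left(F^{-1}\!\left(C-\frac{v^2}{2}\right)\right)} .$$ Suppose that $L_1$ is strictly decreasing on $(s_0,\infty)$. Then the Robin problem $$u''(x)+\lambda f(u(x))=0 \text{ in } (0,L),\qquad u'(0)=\alpha u(0),\quad u'(L)=-\alpha u(L)$$ has at most two solutions that are monotone increasing on $[0,L]$, and at most two solutions that are monotone decreasing on $[0,L]$. (Such solutions are never symmetric about $L/2$.) -/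

import Mathlib

open Set MeasureTheory

noncomputable section

namespace RobinBVP

/-- `u` is a classical solution of `u'' + lam * f u = 0` in `(0, L)`, with
`u' 0 = α * u 0` and `u' L = -α * u L` (one-sided derivatives at the endpoints). -/
structure IsSolution (f : ℝ → ℝ) (α lam L : ℝ) (u : ℝ → ℝ) : Prop where
  contDiffOn : ContDiffOn ℝ 1 u (Icc 0 L)
  ode : ∀ x ∈ Ioo 0 L, HasDerivAt (deriv u) (-(lam * f (u x))) x
  left : derivWithin u (Icc 0 L) 0 = α * u 0
  right : derivWithin u (Icc 0 L) L = -α * u L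

/-- The set of solutions with property `p`, as functions on `[0, L]`. -/
def solutionsOn (f : ℝ → ℝ) (α lam L : ℝ) (p : (ℝ → ℝ) → Prop) : Set (Icc (0 : ℝ) L → ℝ) :=
  (Icc (0 : ℝ) L).domRestrict '' {u | IsSolution f α lam L u ∧ p u}

open Classical in
/-- The primitive of `f`: `∫_{-∞}^u f` if `f` is integrable at `-∞`, `∫_0^u f` otherwise. -/
def F (f : ℝ → ℝ) (u : ℝ) : ℝ :=
  if IntegrableOn f (Iic 0) then ∫ t in Iic u, f t else ∫ t in (0 : ℝ)..u, f t

/-- `s₀ = F 0`. -/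
def s₀ (f : ℝ → ℝ) : ℝ := F f 0

/-- `F⁻¹`, only used on the range of the strictly increasing function `F f`. -/
def Finv (f : ℝ → ℝ) : ℝ → ℝ := Function.invFun (F f)

/-- The curve `u = F⁻¹ (C - v² / 2)` in the `(v, u)` phase plane. -/
def curveK (f : ℝ → ℝ) (C : ℝ) : Set (ℝ × ℝ) := {P | F f P.2 = C - P.1 ^ 2 / 2}

/-- The line `u = γ v` with `γ = √lam / α`, which encodes the boundary condition at `0`. -/
def linePlus (α lam : ℝ) : Set (ℝ × ℝ) := {P | P.2 = (√lam / α) * P.1}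

/-- The `v`-coordinate of the intersection point of the curve and the line with the larger `v`. -/
def v₁ (f : ℝ → ℝ) (α lam C : ℝ) : ℝ := sSup (Prod.fst '' (curveK f C ∩ linePlus α lam))

/-- The length of the interval on which the symmetric solution with energy `C` lives whose
trajectory runs on the curve from `v = v₁` to `v = -v₁`. -/
def L₁ (f : ℝ → ℝ) (α lam C : ℝ) : ℝ :=
  2 * ∫ v in (0 : ℝ)..v₁ f α lam C, 1 / (√lam * f (Finv f (C - v ^ 2 / 2)))

end RobinBVP

end

/-!
With `v = u' / √λ`, a solution runs along an energy curve `F u + v² / 2 = C`, and the boundary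
conditions say that it starts on the ray `u = γ v` and ends on `u = -γ v`, where `γ = √λ / α`. For
an increasing solution both endpoints have `v ≥ 0`. If `C > F 0`, each ray meets the curve once in
`v > 0`, so the solution is determined by `C`, and its length is half of `L₁ α C - L₁ (-α) C`. At
`C = F 0` the starting point is again unique. It therefore suffices that this difference is strictly
decreasing in `C`.

Moving along a ray, the `C`-derivative of a transit time is the integral over the curve of a density
with the sign of `u (f u - u f' u)`. The assumption on `L₁ α` says that the integral from `v = 0` to
the ray `u = γ v` is nonpositive for every energy; what is needed is that the integral between the
two rays is negative. By convexity `f u - u f' u` decreases on `u ≥ 0`, with a last zero `ρ`, say.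
The part of the arc with `u ≥ ρ` contributes a nonpositive amount. The rest is compared with the
curve of energy `F ρ`, at points with the same `u`: the ratio of the two densities is extremal at
`u = 0`, where they change sign, so the part with `u ≤ ρ` is bounded by a positive multiple of the
integral of the lower curve up to its ray, which is nonpositive, plus a strictly negative end piece.
If there is no such zero below the ray `u = -γ v`, the position on that ray plays the role of `ρ`.

The reflection `x ↦ L - x` turns decreasing solutions into increasing ones.
-/

noncomputable section

namespace RobinBVP

open Filter Topology

section Calculus

theorem continuous_deriv_of_convexOn {f : ℝ → ℝ} (hf : Differentiable ℝ f)
    (hconv : ConvexOn ℝ univ f) : Continuous (deriv f) := by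
  have hmono : Monotone (deriv f) :=
    monotoneOn_univ.1 (hconv.monotoneOn_deriv fun x _ => hf x)
  have hderiv : ∀ x, HasDerivAt (fun x => f x + x ^ 2 / 2) (deriv f x + x) x := fun x =>
    ((hf x).hasDerivAt.fun_add ((hasDerivAt_pow 2 x).div_const 2)).congr_deriv (by simp)
  -- The added `x` makes the derivative surjective, and a surjective monotone map is continuous.
  have hsurj : Function.Surjective fun x => deriv f x + x := by
    intro y
    have hdarboux := ordConnected_univ.image_hasDerivWithinAt
      fun x _ => (hderiv x).hasDerivWithinAt
    have hlow : deriv f (min 0 (y - deriv f 0)) + min 0 (y - deriv f 0) ≤ y := by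
      linarith [hmono (min_le_left 0 (y - deriv f 0)), min_le_right 0 (y - deriv f 0)]
    have hhigh : y ≤ deriv f (max 0 (y - deriv f 0)) + max 0 (y - deriv f 0) := by
      linarith [hmono (le_max_left 0 (y - deriv f 0)), le_max_right 0 (y - deriv f 0)]
    rw [image_univ] at hdarboux
    exact hdarboux.out (mem_range_self _) (mem_range_self _) ⟨hlow, hhigh⟩
  have hcont : Continuous fun x => deriv f x + x :=
    (hmono.add_strictMono strictMono_id).monotone.continuous_of_surjective hsurj
  exact (hcont.sub continuous_id).congr fun x => add_sub_cancel_right _ _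

theorem eq_left_of_hasDerivAt_eq_zero {g : ℝ → ℝ} {a b x : ℝ} (hg : ContinuousOn g (Icc a b))
    (hderiv : ∀ x ∈ Ioo a b, HasDerivAt g 0 x) (hx : x ∈ Icc a b) : g x = g a := by
  have ha : a ∈ Icc a b := left_mem_Icc.2 (hx.1.trans hx.2)
  rw [← interior_Icc] at hderiv
  have hwithin := fun x hx => (hderiv x hx).hasDerivWithinAt (s := interior (Icc a b))
  exact le_antisymm
    (antitoneOn_of_hasDerivWithinAt_nonpos (convex_Icc a b) hg hwithin (fun _ _ => le_rfl)
      ha hx hx.1)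
    (monotoneOn_of_hasDerivWithinAt_nonneg (convex_Icc a b) hg hwithin (fun _ _ => le_rfl)
      ha hx hx.1)

theorem intervalIntegrable_of_continuousOn_uncurry {E : Type*} [NormedAddCommGroup E]
    {ψ : ℝ → ℝ → E} {D : Set (ℝ × ℝ)} (hψ : ContinuousOn ↿ψ D) {a b x : ℝ}
    (hseg : {x} ×ˢ uIcc a b ⊆ D) :
    IntervalIntegrable (ψ x) volume a b :=
  (hψ.comp (f := fun w => (x, w)) (by fun_prop) fun _ hw => hseg ⟨rfl, hw⟩).intervalIntegrable

theorem eventually_singleton_prod_uIcc_subset {D : Set (ℝ × ℝ)} (hD : IsOpen D) {b c : ℝ}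
    (hbc : (c, b) ∈ D) : ∀ᶠ p : ℝ × ℝ in 𝓝 (c, b), {p.1} ×ˢ uIcc b p.2 ⊆ D := by
  obtain ⟨s, hs, t, ht, hst⟩ := mem_nhds_prod_iff.1 (hD.mem_nhds hbc)
  have hsegment : ∀ᶠ y in 𝓝 b, uIcc b y ⊆ t :=
    (tendsto_const_nhds.uIcc tendsto_id).eventually (eventually_smallSets_subset.2 ht)
  rw [nhds_prod_eq]
  filter_upwards [Eventually.prod_mk (eventually_mem_set.2 hs) hsegment] with p hp
  exact (prod_mono (singleton_subset_iff.2 hp.1) hp.2).trans hst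

theorem eventually_singleton_prod_subset {D : Set (ℝ × ℝ)} (hD : IsOpen D) {c : ℝ} {K : Set ℝ}
    (hK : IsCompact K) (hcK : {c} ×ˢ K ⊆ D) : ∀ᶠ x in 𝓝 c, {x} ×ˢ K ⊆ D := by
  obtain ⟨s, t, hs, -, hcs, hKt, hst⟩ := generalized_tube_lemma isCompact_singleton hK hD hcK
  filter_upwards [hs.mem_nhds (singleton_subset_iff.1 hcs)] with x hx
  exact (prod_mono (singleton_subset_iff.2 hx) hKt).trans hst

variable {E : Type*} [NormedAddCommGroup E] [NormedSpace ℝ E]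

theorem hasDerivAt_integral_of_continuousOn {ψ ψ' : ℝ → ℝ → E} {D : Set (ℝ × ℝ)} (hD : IsOpen D)
    (hψ : ContinuousOn ↿ψ D) (hψ' : ContinuousOn ↿ψ' D)
    (hderiv : ∀ p ∈ D, HasDerivAt (ψ · p.2) (ψ' p.1 p.2) p.1) {a b c : ℝ}
    (hseg : {c} ×ˢ uIcc a b ⊆ D) :
    HasDerivAt (fun x => ∫ w in a..b, ψ x w) (∫ w in a..b, ψ' c w) c := by
  have htube := eventually_singleton_prod_subset hD isCompact_uIcc hseg
  obtain ⟨K, hK, hKD, hKc⟩ := local_compact_nhds htube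
  have hbox : K ×ˢ uIcc a b ⊆ D := fun p hp => hKD hp.1 ⟨rfl, hp.2⟩
  obtain ⟨M, hM⟩ := (hKc.prod isCompact_uIcc).exists_bound_of_continuousOn (hψ'.mono hbox)
  exact (intervalIntegral.hasDerivAt_integral_of_dominated_loc_of_deriv_le (bound := fun _ => M) hK
    (htube.mono fun x hx => (intervalIntegrable_of_continuousOn_uncurry hψ
      hx).aestronglyMeasurable_restrict_uIoc)
    (intervalIntegrable_of_continuousOn_uncurry hψ hseg)
    (intervalIntegrable_of_continuousOn_uncurry hψ' hseg).aestronglyMeasurable_restrict_uIoc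
    (ae_of_all _ fun w hw x hx => hM (x, w) ⟨hx, uIoc_subset_uIcc hw⟩) intervalIntegrable_const
    (ae_of_all _ fun w hw x hx => hderiv (x, w) (hbox ⟨hx, uIoc_subset_uIcc hw⟩))).2

theorem isLittleO_integral_sub_smul [CompleteSpace E] {ψ : ℝ → ℝ → E} {D : Set (ℝ × ℝ)}
    (hD : IsOpen D) (hψ : ContinuousOn ↿ψ D) {b c : ℝ} (hbc : (c, b) ∈ D) :
    (fun p : ℝ × ℝ => (∫ w in b..p.2, ψ p.1 w) - (p.2 - b) • ψ c b) =o[𝓝 (c, b)]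
      fun p => p.2 - b := by
  refine Asymptotics.isLittleO_iff.2 fun ε hε => ?_
  have hDε : IsOpen (D ∩ ↿ψ ⁻¹' Metric.ball (ψ c b) ε) :=
    hψ.isOpen_inter_preimage hD Metric.isOpen_ball
  filter_upwards [eventually_singleton_prod_uIcc_subset hDε ⟨hbc, Metric.mem_ball_self hε⟩]
    with ⟨x, y⟩ hxy
  have hint : IntervalIntegrable (ψ x) volume b y :=
    intervalIntegrable_of_continuousOn_uncurry hψ (hxy.trans inter_subset_left)
  rw [← intervalIntegral.integral_const,
    ← intervalIntegral.integral_sub hint intervalIntegrable_const]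
  refine intervalIntegral.norm_integral_le_of_norm_le_const fun w hw => ?_
  rw [← dist_eq_norm]
  exact (hxy (mk_mem_prod (mem_singleton x) (uIoc_subset_uIcc hw))).2.le

theorem hasDerivAt_integral_moving_endpoint [CompleteSpace E] {ψ ψ' : ℝ → ℝ → E}
    {D : Set (ℝ × ℝ)} (hD : IsOpen D) (hψ : ContinuousOn ↿ψ D) (hψ' : ContinuousOn ↿ψ' D)
    (hderiv : ∀ p ∈ D, HasDerivAt (ψ · p.2) (ψ' p.1 p.2) p.1) {q : ℝ → ℝ} {a c q' : ℝ}
    (hseg : {c} ×ˢ uIcc a (q c) ⊆ D) (hq : HasDerivAt q q' c) :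
    HasDerivAt (fun x => ∫ w in a..q x, ψ x w) ((∫ w in a..q c, ψ' c w) + q' • ψ c (q c)) c := by
  have hfixed := hasDerivAt_integral_of_continuousOn hD hψ hψ' hderiv hseg
  have hend : (c, q c) ∈ D := hseg ⟨rfl, right_mem_uIcc⟩
  have hgraph : Tendsto (fun x => (x, q x)) (𝓝 c) (𝓝 (c, q c)) :=
    tendsto_id.prodMk_nhds hq.continuousAt.tendsto
  have hmoving : HasDerivAt (fun x => ∫ w in q c..q x, ψ x w) (q' • ψ c (q c)) c := by
    have hlittle := ((isLittleO_integral_sub_smul hD hψ hend).comp_tendsto hgraph).trans_isBigO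
      hq.isBigO_sub
    rw [hasDerivAt_iff_isLittleO]
    refine (hlittle.add (hasDerivAt_iff_isLittleO.1 (hq.smul_const (ψ c (q c))))).congr_left ?_
    intro x
    simp only [Function.comp_apply, intervalIntegral.integral_same]
    module
  refine (hfixed.fun_add hmoving).congr_of_eventuallyEq ?_
  filter_upwards [hgraph.eventually (eventually_singleton_prod_uIcc_subset hD hend),
    eventually_singleton_prod_subset hD isCompact_uIcc hseg] with x hmove hfix
  exact (intervalIntegral.integral_add_adjacent_intervals
    (intervalIntegrable_of_continuousOn_uncurry hψ hfix)
    (intervalIntegrable_of_continuousOn_uncurry hψ hmove)).symm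

end Calculus

section Primitive

variable {f : ℝ → ℝ}

theorem F_Finv {y : ℝ} (hy : y ∈ range (F f)) : F f (Finv f y) = y :=
  Function.invFun_eq hy

theorem hasStrictDerivAt_F (hf : Continuous f) (u : ℝ) : HasStrictDerivAt (F f) (f u) u := by
  have hint : HasStrictDerivAt (fun u => ∫ t in (0 : ℝ)..u, f t) (f u) u :=
    intervalIntegral.integral_hasStrictDerivAt_right (hf.intervalIntegrable _ _)
      hf.stronglyMeasurable.stronglyMeasurableAtFilter hf.continuousAt
  by_cases hi : IntegrableOn f (Iic 0)
  · have hIic : ∀ x, IntegrableOn f (Iic x) := fun x =>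
      (hi.union (hf.integrableOn_Icc (a := 0) (b := x))).mono_set fun y hy =>
        (le_total y 0).imp id fun h0 => ⟨h0, hy⟩
    have heq : F f = fun u => (∫ t in Iic (0 : ℝ), f t) + ∫ t in (0 : ℝ)..u, f t := by
      funext x
      rw [F, if_pos hi, ← intervalIntegral.integral_Iic_sub_Iic hi (hIic x), add_sub_cancel]
    exact heq ▸ hint.const_add _
  · have heq : F f = fun u => ∫ t in (0 : ℝ)..u, f t := funext fun x => if_neg hi
    exact heq ▸ hint

theorem hasDerivAt_F (hf : Continuous f) (u : ℝ) : HasDerivAt (F f) (f u) u :=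
  (hasStrictDerivAt_F hf u).hasDerivAt

theorem continuous_F (hf : Continuous f) : Continuous (F f) :=
  continuous_iff_continuousAt.2 fun u => (hasDerivAt_F hf u).continuousAt

theorem F_add_mul_sub_le (hf : Continuous f) (hmono : Monotone f) (a b : ℝ) :
    F f a + f a * (b - a) ≤ F f b := by
  have hconv : ConvexOn ℝ univ (F f) := by
    refine Monotone.convexOn_univ_of_deriv (fun u => (hasDerivAt_F hf u).differentiableAt) ?_
    rwa [funext fun u => (hasDerivAt_F hf u).deriv]
  rcases lt_trichotomy a b with hab | rfl | hab
  · have hslope := hconv.le_slope_of_hasDerivAt (mem_univ a) (mem_univ b) hab (hasDerivAt_F hf a)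
    rw [slope_def_field, le_div_iff₀ (sub_pos.2 hab)] at hslope
    linarith
  · simp
  · have hslope := hconv.slope_le_of_hasDerivAt (mem_univ b) (mem_univ a) hab (hasDerivAt_F hf a)
    rw [slope_def_field, div_le_iff₀ (sub_pos.2 hab)] at hslope
    linarith

variable (hf : Continuous f) (hpos : ∀ u, 0 < f u)

include hf hpos

theorem strictMono_F : StrictMono (F f) :=
  strictMono_of_hasDerivAt_pos (hasDerivAt_F hf) hpos

theorem Finv_F (u : ℝ) : Finv f (F f u) = u :=
  Function.leftInverse_invFun (strictMono_F hf hpos).injective u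

theorem isOpen_range_F : IsOpen (range (F f)) :=
  (isOpenMap_of_hasStrictDerivAt (hasStrictDerivAt_F hf) fun u => (hpos u).ne').isOpen_range

theorem hasStrictDerivAt_Finv {y : ℝ} (hy : y ∈ range (F f)) :
    HasStrictDerivAt (Finv f) (1 / f (Finv f y)) y := by
  obtain ⟨u, rfl⟩ := hy
  rw [Finv_F hf hpos, one_div]
  exact (hasStrictDerivAt_F hf u).to_local_left_inverse (hpos u).ne'
    (Eventually.of_forall (Finv_F hf hpos))

theorem isUpperSet_range_F (hmono : Monotone f) : IsUpperSet (range (F f)) := by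
  rintro _ y hy ⟨u, rfl⟩
  have hb : y ≤ F f (u + (y - F f u) / f u) := by
    have htangent := F_add_mul_sub_le hf hmono u (u + (y - F f u) / f u)
    rwa [add_sub_cancel_left, mul_div_cancel₀ _ (hpos u).ne', add_sub_cancel] at htangent
  exact mem_range_of_exists_le_of_exists_ge (continuous_F hf) ⟨u, hy⟩ ⟨_, hb⟩

end Primitive

section Rays

variable {f : ℝ → ℝ}

/-- The energy `F u + v ^ 2 / 2` at the point `v = q` of the ray `u = τ * v`. -/
def rayEnergy (f : ℝ → ℝ) (τ q : ℝ) : ℝ := F f (τ * q) + q ^ 2 / 2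

/-- The rate `w * u' - u * w'` at which the flow `u' = w`, `w' = -f u` sweeps out twice the area
seen from the origin. -/
def arealSpeed (f : ℝ → ℝ) (u w : ℝ) : ℝ := w ^ 2 + u * f u

theorem hasStrictDerivAt_rayEnergy (hf : Continuous f) (τ q : ℝ) :
    HasStrictDerivAt (rayEnergy f τ) (τ * f (τ * q) + q) q := by
  have hline : HasStrictDerivAt (τ * ·) τ q :=
    ((hasStrictDerivAt_id q).const_mul τ).congr_deriv (mul_one τ)
  have hsq : HasStrictDerivAt (fun q : ℝ => q ^ 2 / 2) q q :=
    ((hasStrictDerivAt_pow 2 q).div_const 2).congr_deriv (by simp)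
  exact (((hasStrictDerivAt_F hf (τ * q)).comp q hline).fun_add hsq).congr_deriv (by ring)

theorem continuous_rayEnergy (hf : Continuous f) (τ : ℝ) : Continuous (rayEnergy f τ) :=
  continuous_iff_continuousAt.2 fun q => (hasStrictDerivAt_rayEnergy hf τ q).hasDerivAt.continuousAt

variable (hf : Continuous f) (hmono : Monotone f)

include hf hmono

theorem F_add_sq_sub_le_arealSpeed (u w : ℝ) : F f u + w ^ 2 / 2 - F f 0 ≤ arealSpeed f u w := by
  rw [arealSpeed]
  linarith [F_add_mul_sub_le hf hmono u 0, sq_nonneg w]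

theorem arealSpeed_pos {u w : ℝ} (h : F f 0 < F f u + w ^ 2 / 2) : 0 < arealSpeed f u w := by
  linarith [F_add_sq_sub_le_arealSpeed hf hmono u w]

theorem strictConvexOn_rayEnergy (τ : ℝ) : StrictConvexOn ℝ univ (rayEnergy f τ) := by
  refine StrictMono.strictConvexOn_univ_of_deriv (continuous_rayEnergy hf τ) ?_
  have hmonoτ : Monotone fun q => τ * f (τ * q) := by
    rcases le_total 0 τ with hτ | hτ
    · exact fun a b hab => mul_le_mul_of_nonneg_left (hmono (mul_le_mul_of_nonneg_left hab hτ)) hτ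
    · exact fun a b hab => mul_le_mul_of_nonpos_left (hmono (mul_le_mul_of_nonpos_left hab hτ)) hτ
  rw [funext fun q => (hasStrictDerivAt_rayEnergy hf τ q).hasDerivAt.deriv]
  exact hmonoτ.add_strictMono strictMono_id

theorem strictMonoOn_rayEnergy (τ : ℝ) :
    StrictMonoOn (rayEnergy f τ) {q | 0 < q ∧ F f 0 ≤ rayEnergy f τ q} := by
  rintro a ⟨ha, hEa⟩ b - hab
  have hslope := (strictConvexOn_rayEnergy hf hmono τ).slope_strict_mono_adjacent
    (mem_univ 0) (mem_univ b) ha hab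
  have hzero : rayEnergy f τ 0 = F f 0 := by simp [rayEnergy]
  have hleft : 0 ≤ (rayEnergy f τ a - rayEnergy f τ 0) / (a - 0) :=
    div_nonneg (by linarith) (by linarith)
  exact sub_pos.1 ((div_pos_iff_of_pos_right (sub_pos.2 hab)).1 (hleft.trans_lt hslope))

theorem exists_rayEnergy_eq (τ : ℝ) {C : ℝ} (hC : F f 0 < C) :
    ∃ q, 0 < q ∧ rayEnergy f τ q = C := by
  have hlower : ∀ q, F f 0 + q * (q / 2 + τ * f 0) ≤ rayEnergy f τ q := fun q => by
    rw [rayEnergy]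
    linarith [F_add_mul_sub_le hf hmono 0 (τ * q)]
  have htop : Tendsto (fun q => F f 0 + q * (q / 2 + τ * f 0)) atTop atTop :=
    tendsto_atTop_add_const_left _ _ <| tendsto_id.atTop_mul_atTop₀ <|
      tendsto_atTop_add_const_right _ _ <| tendsto_id.atTop_div_const two_pos
  obtain ⟨b, hbC, hb⟩ := (((tendsto_atTop_mono hlower htop).eventually_ge_atTop C).and
    (eventually_ge_atTop 0)).exists
  have hzero : rayEnergy f τ 0 = F f 0 := by simp [rayEnergy]
  obtain ⟨q, hq, hqC⟩ := intermediate_value_Icc hb (continuous_rayEnergy hf τ).continuousOn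
    ⟨hzero.trans_le hC.le, hbC⟩
  refine ⟨q, hq.1.lt_of_ne' ?_, hqC⟩
  rintro rfl
  exact hC.ne (hzero.symm.trans hqC)

variable {α lam : ℝ}

theorem v₁_rayEnergy {q : ℝ} (hq : 0 < q) (hE : F f 0 ≤ rayEnergy f (√lam / α) q) :
    v₁ f α lam (rayEnergy f (√lam / α) q) = q := by
  refine IsGreatest.csSup_eq ⟨⟨(q, √lam / α * q), ⟨?_, rfl⟩, rfl⟩, ?_⟩
  · simp [curveK, rayEnergy]
  rintro _ ⟨⟨w, u⟩, ⟨hcurve, hline⟩, rfl⟩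
  obtain rfl : u = √lam / α * w := hline
  have hw : rayEnergy f (√lam / α) w = rayEnergy f (√lam / α) q := add_eq_of_eq_sub hcurve
  rcases le_or_gt w 0 with hw0 | hw0
  · exact hw0.trans hq.le
  · exact ((strictMonoOn_rayEnergy hf hmono _).injOn ⟨hw0, hw ▸ hE⟩ ⟨hq, hE⟩ hw).le

section AboveThreshold

variable {C : ℝ} (hC : F f 0 < C)

include hC

theorem v₁_pos : 0 < v₁ f α lam C := by
  obtain ⟨q, hq, rfl⟩ := exists_rayEnergy_eq hf hmono (√lam / α) hC
  rwa [v₁_rayEnergy hf hmono hq hC.le]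

theorem rayEnergy_v₁ : rayEnergy f (√lam / α) (v₁ f α lam C) = C := by
  obtain ⟨q, hq, rfl⟩ := exists_rayEnergy_eq hf hmono (√lam / α) hC
  rw [v₁_rayEnergy hf hmono hq hC.le]

theorem hasDerivAt_v₁ : HasDerivAt (v₁ f α lam)
    (v₁ f α lam C / arealSpeed f (√lam / α * v₁ f α lam C) (v₁ f α lam C)) C := by
  obtain ⟨q, hq, rfl⟩ := exists_rayEnergy_eq hf hmono (√lam / α) hC
  rw [v₁_rayEnergy hf hmono hq hC.le]
  have hspeed := arealSpeed_pos hf hmono hC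
  have hradial : arealSpeed f (√lam / α * q) q = q * (√lam / α * f (√lam / α * q) + q) := by
    rw [arealSpeed]; ring
  rw [hradial] at hspeed ⊢
  have hleft : ∀ᶠ x in 𝓝 q, v₁ f α lam (rayEnergy f (√lam / α) x) = x := by
    filter_upwards [lt_mem_nhds hq,
      (continuous_rayEnergy hf (√lam / α)).continuousAt.eventually (lt_mem_nhds hC)]
      with x hx hxE
    exact v₁_rayEnergy hf hmono hx hxE.le
  refine ((hasStrictDerivAt_rayEnergy hf (√lam / α) q).to_local_left_inverse
    (pos_of_mul_pos_right hspeed hq.le).ne' hleft).hasDerivAt.congr_deriv ?_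
  rw [div_mul_cancel_left₀ hq.ne']

end AboveThreshold

theorem strictMonoOn_v₁ : StrictMonoOn (v₁ f α lam) (Ioi (F f 0)) := by
  intro C hC C' hC' hCC'
  have hmem : ∀ {c : ℝ}, F f 0 < c →
      v₁ f α lam c ∈ {q | 0 < q ∧ F f 0 ≤ rayEnergy f (√lam / α) q} := fun hc =>
    ⟨v₁_pos hf hmono hc, hc.le.trans_eq (rayEnergy_v₁ hf hmono hc).symm⟩
  refine ((strictMonoOn_rayEnergy hf hmono _).lt_iff_lt (hmem hC) (hmem hC')).1 ?_
  rwa [rayEnergy_v₁ hf hmono hC, rayEnergy_v₁ hf hmono hC']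

end Rays

section TransitTime

variable {f : ℝ → ℝ}

/-- The pairs `(C, w)` of an energy and a velocity for which the curve `F u + v ^ 2 / 2 = C` has a
point with `v = w`. -/
def curveDomain (f : ℝ → ℝ) : Set (ℝ × ℝ) := {p | p.1 - p.2 ^ 2 / 2 ∈ range (F f)}

/-- The position `u` at the point `v = w` of the curve `F u + v ^ 2 / 2 = C`. -/
def curvePos (f : ℝ → ℝ) (C w : ℝ) : ℝ := Finv f (C - w ^ 2 / 2)

/-- The time that the flow `u' = v`, `v' = -f u` takes along the curve of energy `C` from `v = w`
to `v = 0`. -/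
def transitTime (f : ℝ → ℝ) (C w : ℝ) : ℝ := ∫ s in (0 : ℝ)..w, 1 / f (curvePos f C s)

/-- The ordinate at the origin of the tangent line to the graph of `f` at `u`. -/
def tangentIntercept (f : ℝ → ℝ) (u : ℝ) : ℝ := f u - u * deriv f u

/-- The derivative of `transitTime` with respect to the energy along a ray through the origin is the
integral of this density over the velocities, with `u = curvePos f C w`. -/
def transitRate (f : ℝ → ℝ) (u w : ℝ) : ℝ :=
  tangentIntercept f u * u / (f u * arealSpeed f u w ^ 2)

theorem L₁_eq_transitTime (α lam C : ℝ) :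
    L₁ f α lam C = 2 / √lam * transitTime f C (v₁ f α lam C) := by
  rw [L₁, transitTime, ← intervalIntegral.integral_const_mul,
    ← intervalIntegral.integral_const_mul]
  simp only [curvePos, mul_one_div, div_div]

theorem F_curvePos {C w : ℝ} (h : (C, w) ∈ curveDomain f) :
    F f (curvePos f C w) + w ^ 2 / 2 = C := by
  rw [curvePos, F_Finv h, sub_add_cancel]

theorem mem_curveDomain_of_F_add {u w C : ℝ} (h : F f u + w ^ 2 / 2 = C) :
    (C, w) ∈ curveDomain f := ⟨u, eq_sub_of_add_eq h⟩

section Pos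

variable (hf : Continuous f) (hpos : ∀ u, 0 < f u)

include hf hpos

theorem isOpen_curveDomain : IsOpen (curveDomain f) :=
  (isOpen_range_F hf hpos).preimage (by fun_prop : Continuous fun p : ℝ × ℝ => p.1 - p.2 ^ 2 / 2)

theorem curvePos_eq_of_F_add {u w C : ℝ} (h : F f u + w ^ 2 / 2 = C) : curvePos f C w = u := by
  rw [curvePos, ← eq_sub_of_add_eq h, Finv_F hf hpos]

theorem continuousOn_curvePos : ContinuousOn ↿(curvePos f) (curveDomain f) := fun p hp =>
  ((hasStrictDerivAt_Finv hf hpos hp).hasDerivAt.continuousAt.comp (f := fun p : ℝ × ℝ =>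
    p.1 - p.2 ^ 2 / 2) (by fun_prop)).continuousWithinAt

theorem strictAntiOn_curvePos (C : ℝ) :
    StrictAntiOn (curvePos f C) {w | 0 ≤ w ∧ (C, w) ∈ curveDomain f} := by
  rintro x ⟨hx0, hx⟩ y ⟨-, hy⟩ hxy
  refine (strictMono_F hf hpos).lt_iff_lt.1 ?_
  linarith [F_curvePos hx, F_curvePos hy, pow_lt_pow_left₀ hxy hx0 two_ne_zero]

theorem hasDerivAt_curvePos_energy {C w : ℝ} (h : (C, w) ∈ curveDomain f) :
    HasDerivAt (curvePos f · w) (1 / f (curvePos f C w)) C :=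
  ((hasStrictDerivAt_Finv hf hpos h).hasDerivAt.comp C
    ((hasDerivAt_id' C).sub_const (w ^ 2 / 2))).congr_deriv (mul_one _)

theorem hasDerivAt_curvePos_velocity {C w : ℝ} (h : (C, w) ∈ curveDomain f) :
    HasDerivAt (curvePos f C) (-w / f (curvePos f C w)) w := by
  refine ((hasStrictDerivAt_Finv hf hpos h).hasDerivAt.comp w
    (((hasDerivAt_pow 2 w).div_const 2).const_sub C)).congr_deriv ?_
  rw [curvePos]
  push_cast
  ring

theorem continuousOn_one_div_comp_curvePos :
    ContinuousOn ↿(fun C w => 1 / f (curvePos f C w)) (curveDomain f) :=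
  continuousOn_const.div (hf.comp_continuousOn (continuousOn_curvePos hf hpos))
    fun _ _ => (hpos _).ne'

theorem mem_curveDomain_of_abs_le (hmono : Monotone f) {C w x : ℝ}
    (hw : (C, w) ∈ curveDomain f) (hx : |x| ≤ |w|) : (C, x) ∈ curveDomain f :=
  isUpperSet_range_F hf hpos hmono (by linarith [sq_le_sq.2 hx]) hw

theorem singleton_prod_uIcc_subset_curveDomain (hmono : Monotone f) {C a b w : ℝ}
    (hw : (C, w) ∈ curveDomain f) (ha : |a| ≤ |w|) (hb : |b| ≤ |w|) :
    {C} ×ˢ uIcc a b ⊆ curveDomain f := by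
  rintro ⟨_, x⟩ ⟨rfl, hx⟩
  exact mem_curveDomain_of_abs_le hf hpos hmono hw
    (abs_le.2 (uIcc_subset_Icc (abs_le.1 ha) (abs_le.1 hb) hx))

theorem hasDerivAt_transitTime (hmono : Monotone f) {C w : ℝ} (hw : (C, w) ∈ curveDomain f) :
    HasDerivAt (transitTime f C) (1 / f (curvePos f C w)) w := by
  have hcont : ContinuousOn (fun s => 1 / f (curvePos f C s)) {s | (C, s) ∈ curveDomain f} :=
    (continuousOn_one_div_comp_curvePos hf hpos).comp (f := fun s => (C, s)) (by fun_prop)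
      fun _ hs => hs
  have hopen : IsOpen {s | (C, s) ∈ curveDomain f} :=
    (isOpen_curveDomain hf hpos).preimage (by fun_prop)
  have hint : IntervalIntegrable (fun s => 1 / f (curvePos f C s)) volume 0 w :=
    intervalIntegrable_of_continuousOn_uncurry (ψ := fun C w => 1 / f (curvePos f C w))
      (continuousOn_one_div_comp_curvePos hf hpos)
      (singleton_prod_uIcc_subset_curveDomain hf hpos hmono hw (by simp) le_rfl)
  exact intervalIntegral.integral_hasDerivAt_right hint
    (hcont.stronglyMeasurableAtFilter hopen w hw) (hcont.continuousAt (hopen.mem_nhds hw))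

theorem ordConnected_curveDomain (hmono : Monotone f) (C : ℝ) :
    OrdConnected {w | (C, w) ∈ curveDomain f} := by
  refine ⟨fun x hx y hy z hz => ?_⟩
  rcases le_max_iff.1 (abs_le_max_abs_abs hz.1 hz.2) with h | h
  · exact mem_curveDomain_of_abs_le hf hpos hmono hx h
  · exact mem_curveDomain_of_abs_le hf hpos hmono hy h

theorem strictMonoOn_transitTime (hmono : Monotone f) (C : ℝ) :
    StrictMonoOn (transitTime f C) {w | (C, w) ∈ curveDomain f} := by
  have hderiv := fun w (hw : (C, w) ∈ curveDomain f) => hasDerivAt_transitTime hf hpos hmono hw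
  refine strictMonoOn_of_deriv_pos (ordConnected_curveDomain hf hpos hmono C).convex
    (fun w hw => (hderiv w hw).continuousAt.continuousWithinAt) fun w hw => ?_
  have hw' : w ∈ {w | (C, w) ∈ curveDomain f} := interior_subset hw
  rw [(hderiv w hw').deriv]
  exact one_div_pos.2 (hpos _)

end Pos

section Rate

variable (hf : ContDiff ℝ 1 f) (hpos : ∀ u, 0 < f u)

include hf in
theorem continuous_tangentIntercept : Continuous (tangentIntercept f) :=
  hf.continuous.sub (continuous_id.mul (hf.continuous_deriv le_rfl))

include hf hpos

theorem hasDerivAt_one_div_comp_curvePos {C w : ℝ} (h : (C, w) ∈ curveDomain f) :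
    HasDerivAt (fun C => 1 / f (curvePos f C w))
      (-deriv f (curvePos f C w) / f (curvePos f C w) ^ 3) C := by
  have hne := (hpos (curvePos f C w)).ne'
  have hcomp := (hf.differentiable one_ne_zero (curvePos f C w)).hasDerivAt.comp C
    (hasDerivAt_curvePos_energy hf.continuous hpos h)
  simp only [one_div]
  refine (hcomp.fun_inv hne).congr_deriv ?_
  rw [Function.comp_apply]
  field_simp

theorem continuousOn_deriv_div_curvePos : ContinuousOn
    ↿(fun C w => -deriv f (curvePos f C w) / f (curvePos f C w) ^ 3) (curveDomain f) := by
  have hpos' := continuousOn_curvePos hf.continuous hpos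
  exact ((hf.continuous_deriv le_rfl).comp_continuousOn hpos').neg.div
    ((hf.continuous.comp_continuousOn hpos').pow 3) fun p _ => (pow_pos (hpos _) 3).ne'

theorem continuousOn_transitRate_curvePos (hmono : Monotone f) {C : ℝ} (hC : F f 0 < C) {K : Set ℝ}
    (hK : {C} ×ˢ K ⊆ curveDomain f) :
    ContinuousOn (fun w => transitRate f (curvePos f C w) w) K := by
  have hu : ContinuousOn (curvePos f C) K :=
    (continuousOn_curvePos hf.continuous hpos).comp (f := fun w => (C, w)) (by fun_prop)
      fun w hw => hK ⟨rfl, hw⟩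
  have hfu := hf.continuous.comp_continuousOn hu
  refine (((continuous_tangentIntercept hf).comp_continuousOn hu).mul hu).div
    (hfu.mul (((continuousOn_id.pow 2).add (hu.mul hfu)).pow 2)) fun w hw => ?_
  have hE : (C, w) ∈ curveDomain f := hK ⟨rfl, hw⟩
  have hS : 0 < arealSpeed f (curvePos f C w) w :=
    arealSpeed_pos hf.continuous hmono (hC.trans_eq (F_curvePos hE).symm)
  exact (mul_pos (hpos _) (pow_pos hS 2)).ne'

theorem intervalIntegrable_transitRate (hmono : Monotone f) {C w x y : ℝ} (hC : F f 0 < C)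
    (hw : (C, w) ∈ curveDomain f) (hx : |x| ≤ |w|) (hy : |y| ≤ |w|) :
    IntervalIntegrable (fun w => transitRate f (curvePos f C w) w) volume x y :=
  (continuousOn_transitRate_curvePos hf hpos hmono hC
    (singleton_prod_uIcc_subset_curveDomain hf.continuous hpos hmono hw hx hy)).intervalIntegrable

/-- The quotient is the rate at which `transitTime` grows through the motion of its endpoint when
the energy increases and that endpoint stays on its ray. -/
theorem hasDerivAt_div_arealSpeed (hmono : Monotone f) {C w : ℝ} (hC : F f 0 < C)
    (h : (C, w) ∈ curveDomain f) :
    HasDerivAt (fun w => w / (f (curvePos f C w) * arealSpeed f (curvePos f C w) w))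
      (transitRate f (curvePos f C w) w -
        -deriv f (curvePos f C w) / f (curvePos f C w) ^ 3) w := by
  have hu := hasDerivAt_curvePos_velocity hf.continuous hpos h
  have hfu := (hf.differentiable one_ne_zero (curvePos f C w)).hasDerivAt.comp w hu
  have hS : 0 < arealSpeed f (curvePos f C w) w :=
    arealSpeed_pos hf.continuous hmono (hC.trans_eq (F_curvePos h).symm)
  have hSw := (hasDerivAt_pow 2 w).fun_add (hu.fun_mul hfu)
  have hne := hpos (curvePos f C w)
  refine ((hasDerivAt_id' w).fun_div (hfu.fun_mul hSw) (mul_pos hne hS).ne').congr_deriv ?_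
  simp only [Function.comp_apply, transitRate, tangentIntercept, arealSpeed] at hS ⊢
  generalize curvePos f C w = u at *
  generalize deriv f u = d
  generalize f u = y at *
  generalize hT : w ^ 2 + u * y = T at *
  rw [(eq_div_iff hne.ne').2 (eq_sub_of_add_eq' hT)]
  field_simp
  ring

end Rate

section RayEndpoint

variable (hf : Continuous f) (hmono : Monotone f) {α lam C : ℝ} (hC : F f 0 < C)

include hf hmono hC

theorem mem_curveDomain_v₁ : (C, v₁ f α lam C) ∈ curveDomain f :=
  mem_curveDomain_of_F_add (rayEnergy_v₁ hf hmono hC)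

theorem curvePos_v₁ (hpos : ∀ u, 0 < f u) :
    curvePos f C (v₁ f α lam C) = √lam / α * v₁ f α lam C :=
  curvePos_eq_of_F_add hf hpos (rayEnergy_v₁ hf hmono hC)

end RayEndpoint

section LengthDerivative

variable (hf : ContDiff ℝ 1 f) (hpos : ∀ u, 0 < f u)

include hf hpos

theorem hasDerivAt_transitTime_v₁ (hmono : Monotone f) (α lam : ℝ) {C : ℝ} (hC : F f 0 < C) :
    HasDerivAt (fun C => transitTime f C (v₁ f α lam C))
      (∫ w in (0 : ℝ)..v₁ f α lam C, transitRate f (curvePos f C w) w) C := by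
  have hcont := hf.continuous
  have hseg : {C} ×ˢ uIcc 0 (v₁ f α lam C) ⊆ curveDomain f :=
    singleton_prod_uIcc_subset_curveDomain hcont hpos hmono
      (mem_curveDomain_v₁ hcont hmono hC) (by simp) le_rfl
  have hleibniz := hasDerivAt_integral_moving_endpoint (isOpen_curveDomain hcont hpos)
    (ψ := fun C w => 1 / f (curvePos f C w)) (continuousOn_one_div_comp_curvePos hcont hpos)
    (continuousOn_deriv_div_curvePos hf hpos)
    (fun p hp => hasDerivAt_one_div_comp_curvePos hf hpos hp) hseg (hasDerivAt_v₁ hcont hmono hC)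
  refine hleibniz.congr_deriv ?_
  have hrate := intervalIntegrable_transitRate hf hpos hmono hC
    (mem_curveDomain_v₁ hcont hmono hC) (by simp : |0| ≤ |v₁ f α lam C|) le_rfl
  have hψ' := intervalIntegrable_of_continuousOn_uncurry
    (continuousOn_deriv_div_curvePos hf hpos) hseg
  have hftc := intervalIntegral.integral_eq_sub_of_hasDerivAt
    (fun w hw => hasDerivAt_div_arealSpeed hf hpos hmono hC (hseg ⟨rfl, hw⟩)) (hrate.sub hψ')
  rw [intervalIntegral.integral_sub hrate hψ', zero_div, sub_zero] at hftc
  rw [sub_eq_iff_eq_add'.1 hftc, curvePos_v₁ hcont hmono hC hpos, smul_eq_mul]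
  field_simp

theorem hasDerivAt_L₁ (hmono : Monotone f) (α lam : ℝ) {C : ℝ} (hC : F f 0 < C) :
    HasDerivAt (L₁ f α lam)
      (2 / √lam * ∫ w in (0 : ℝ)..v₁ f α lam C, transitRate f (curvePos f C w) w) C := by
  rw [funext (L₁_eq_transitTime α lam)]
  exact (hasDerivAt_transitTime_v₁ hf hpos hmono α lam hC).const_mul _

end LengthDerivative

end TransitTime

section Comparison

theorem mapsTo_sqrt_sq_add (a δ : ℝ) :
    MapsTo (fun x => √(x ^ 2 + δ)) (Icc 0 a) (Icc √δ √(a ^ 2 + δ)) := fun x hx =>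
  ⟨Real.sqrt_le_sqrt (le_add_of_nonneg_left (sq_nonneg x)),
    Real.sqrt_le_sqrt (by linarith [pow_le_pow_left₀ hx.1 hx.2 2])⟩

theorem continuous_div_sqrt_sq_add {δ : ℝ} (hδ : 0 < δ) :
    Continuous fun x : ℝ => x / √(x ^ 2 + δ) :=
  continuous_id.div (by fun_prop) fun x => (Real.sqrt_pos.2 (by positivity)).ne'

theorem integral_sqrt_sq_add {φ : ℝ → ℝ} {a δ : ℝ} (ha : 0 ≤ a) (hδ : 0 < δ)
    (hφ : ContinuousOn φ (Icc √δ √(a ^ 2 + δ))) :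
    ∫ w in √δ..√(a ^ 2 + δ), φ w = ∫ x in (0 : ℝ)..a, φ √(x ^ 2 + δ) * (x / √(x ^ 2 + δ)) := by
  have hderiv : ∀ x : ℝ, HasDerivAt (fun x => √(x ^ 2 + δ)) (x / √(x ^ 2 + δ)) x := fun x => by
    refine (((hasDerivAt_pow 2 x).add_const δ).sqrt (by positivity)).congr_deriv ?_
    field_simp
    simp
  have himage : (fun x => √(x ^ 2 + δ)) '' uIcc 0 a ⊆ Icc √δ √(a ^ 2 + δ) := by
    rw [uIcc_of_le ha]
    exact (mapsTo_sqrt_sq_add a δ).image_subset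
  have hsubst := intervalIntegral.integral_comp_mul_deriv' (fun x _ => hderiv x)
    (continuous_div_sqrt_sq_add hδ).continuousOn (hφ.mono himage)
  rw [zero_pow two_ne_zero, zero_add] at hsubst
  exact hsubst.symm

theorem sub_div_sub_le_sub_div_sub {c₀ c₁ p q : ℝ} (hc : c₀ ≤ c₁) (hpq : p ≤ q) (hq : q < c₁) :
    (c₀ - q) / (c₁ - q) ≤ (c₀ - p) / (c₁ - p) := by
  rw [div_le_div_iff₀ (sub_pos.2 hq) (by linarith)]
  nlinarith

variable {f : ℝ → ℝ}

theorem antitoneOn_tangentIntercept (hf : Differentiable ℝ f) (hconv : ConvexOn ℝ univ f) :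
    AntitoneOn (tangentIntercept f) (Ici 0) := by
  rintro a ha b - hab
  rcases hab.eq_or_lt with rfl | hab
  · rfl
  have hslope := hconv.slope_le_deriv (mem_univ a) (mem_univ b) hab (hf b)
  rw [slope_def_field, div_le_iff₀ (sub_pos.2 hab)] at hslope
  have hderiv := hconv.monotoneOn_deriv (fun x _ => hf x) (mem_univ a) (mem_univ b) hab.le
  rw [tangentIntercept, tangentIntercept]
  linarith [mul_le_mul_of_nonneg_left hderiv ha]

theorem tangentIntercept_pos (hpos : ∀ u, 0 < f u) (hmono : Monotone f) {u : ℝ} (hu : u ≤ 0) :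
    0 < tangentIntercept f u := by
  rw [tangentIntercept]
  linarith [hpos u, mul_nonpos_of_nonpos_of_nonneg hu (hmono.deriv_nonneg (x := u))]

theorem exists_tangentIntercept_sign_change (hf : ContDiff ℝ 1 f) (hpos : ∀ u, 0 < f u)
    (hmono : Monotone f) (hconv : ConvexOn ℝ univ f) {β : ℝ} (hβ : 0 < β) :
    ∃ ρ ∈ Ioc 0 β, 0 ≤ tangentIntercept f ρ ∧ ∀ u ∈ Ioc ρ β, tangentIntercept f u ≤ 0 := by
  rcases le_or_gt 0 (tangentIntercept f β) with hg | hg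
  · exact ⟨β, ⟨hβ, le_rfl⟩, hg, by simp⟩
  have hzero := tangentIntercept_pos hpos hmono le_rfl
  obtain ⟨ρ, hρ, hgρ⟩ := intermediate_value_Icc' hβ.le
    (continuous_tangentIntercept hf).continuousOn ⟨hg.le, hzero.le⟩
  refine ⟨ρ, ⟨hρ.1.lt_of_ne' ?_, hρ.2⟩, hgρ.ge, fun u hu => ?_⟩
  · rintro rfl
    exact hzero.ne' hgρ
  · rw [← hgρ]
    exact antitoneOn_tangentIntercept (hf.differentiable one_ne_zero) hconv hρ.1
      (hρ.1.trans hu.1.le) hu.1.le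

theorem monotoneOn_F_sub (hf : Differentiable ℝ f) {s : Set ℝ} (hs : Convex ℝ s)
    (hnonneg : ∀ u ∈ s, 0 ≤ tangentIntercept f u) :
    MonotoneOn (fun u => F f u - u * f u / 2) s := by
  have hderiv : ∀ u, HasDerivAt (fun u => F f u - u * f u / 2) (tangentIntercept f u / 2) u :=
    fun u => ((hasDerivAt_F hf.continuous u).fun_sub
      (((hasDerivAt_id' u).fun_mul (hf u).hasDerivAt).div_const 2)).congr_deriv
        (by rw [tangentIntercept]; ring)
  exact monotoneOn_of_hasDerivWithinAt_nonneg hs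
    (fun u _ => (hderiv u).continuousAt.continuousWithinAt)
    (fun u _ => (hderiv u).hasDerivWithinAt)
    fun u hu => div_nonneg (hnonneg u (interior_subset hu)) two_pos.le

theorem F_zero_le_F_sub (hf : Differentiable ℝ f) (hconv : ConvexOn ℝ univ f) {u : ℝ} (hu : 0 ≤ u)
    (hg : 0 ≤ tangentIntercept f u) : F f 0 ≤ F f u - u * f u / 2 := by
  have hnonneg : ∀ z ∈ Icc 0 u, 0 ≤ tangentIntercept f z := fun z hz =>
    hg.trans (antitoneOn_tangentIntercept hf hconv hz.1 hu hz.2)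
  simpa only [zero_mul, zero_div, sub_zero] using monotoneOn_F_sub hf (convex_Icc 0 u) hnonneg
    (left_mem_Icc.2 hu) (right_mem_Icc.2 hu) hu

theorem F_sub_le_F_zero (hf : Differentiable ℝ f) (hpos : ∀ u, 0 < f u) (hmono : Monotone f)
    {u : ℝ} (hu : u ≤ 0) : F f u - u * f u / 2 ≤ F f 0 := by
  simpa only [zero_mul, zero_div, sub_zero] using monotoneOn_F_sub hf (convex_Iic 0)
    (fun z hz => (tangentIntercept_pos hpos hmono hz).le) hu self_mem_Iic hu

theorem transitRate_neg (hpos : ∀ u, 0 < f u) (hmono : Monotone f) {u w : ℝ} (hu : u < 0)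
    (hS : 0 < arealSpeed f u w) : transitRate f u w < 0 :=
  div_neg_of_neg_of_pos (mul_neg_of_pos_of_neg (tangentIntercept_pos hpos hmono hu.le) hu)
    (mul_pos (hpos u) (pow_pos hS 2))

theorem transitRate_nonneg (hpos : ∀ u, 0 < f u) {u : ℝ} (hu : 0 ≤ u)
    (hg : 0 ≤ tangentIntercept f u) (w : ℝ) : 0 ≤ transitRate f u w :=
  div_nonneg (mul_nonneg hg hu) (mul_nonneg (hpos u).le (sq_nonneg _))

theorem transitRate_nonpos (hpos : ∀ u, 0 < f u) {u : ℝ} (hu : 0 ≤ u)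
    (hg : tangentIntercept f u ≤ 0) (w : ℝ) : transitRate f u w ≤ 0 :=
  div_nonpos_of_nonpos_of_nonneg (mul_nonpos_of_nonpos_of_nonneg hg hu)
    (mul_nonneg (hpos u).le (sq_nonneg _))

theorem transitRate_mul_div_eq {u x y : ℝ} (hx : arealSpeed f u x ≠ 0) :
    transitRate f u y * (x / y) =
      transitRate f u x * ((arealSpeed f u x / arealSpeed f u y) ^ 2 * (x / y)) := by
  rw [transitRate, transitRate]
  field_simp

theorem arealSpeed_eq {C u w : ℝ} (hE : F f u + w ^ 2 / 2 = C) :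
    arealSpeed f u w = 2 * (C - (F f u - u * f u / 2)) := by
  rw [arealSpeed]
  linarith

theorem arealSpeed_ratio_mul_velocity_ratio {C₀ C₁ u x y : ℝ} (hEx : F f u + x ^ 2 / 2 = C₀)
    (hEy : F f u + y ^ 2 / 2 = C₁) (hx : 0 ≤ x) (hy : 0 ≤ y) :
    (arealSpeed f u x / arealSpeed f u y) ^ 2 * (x / y) =
      ((C₀ - (F f u - u * f u / 2)) / (C₁ - (F f u - u * f u / 2))) ^ 2 *
        √((C₀ - F f u) / (C₁ - F f u)) := by
  have hvel : x / y = √((C₀ - F f u) / (C₁ - F f u)) := by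
    rw [← hEx, ← hEy, add_sub_cancel_left, add_sub_cancel_left,
      div_div_div_cancel_right₀ two_ne_zero, ← div_pow, Real.sqrt_sq (div_nonneg hx hy)]
  rw [arealSpeed_eq hEx, arealSpeed_eq hEy, mul_div_mul_left _ _ two_ne_zero, hvel]

theorem transitRate_mul_div_le (hf : Differentiable ℝ f) (hpos : ∀ u, 0 < f u) (hmono : Monotone f)
    (hconv : ConvexOn ℝ univ f) {C₀ C₁ u x y : ℝ} (hC₀ : F f 0 < C₀) (hC : C₀ < C₁)
    (hEx : F f u + x ^ 2 / 2 = C₀) (hEy : F f u + y ^ 2 / 2 = C₁) (hx : 0 ≤ x) (hy : 0 ≤ y)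
    (hu : 0 ≤ u → 0 ≤ tangentIntercept f u) :
    transitRate f u y * (x / y) ≤
      transitRate f u x * (((C₀ - F f 0) / (C₁ - F f 0)) ^ 2 * √((C₀ - F f 0) / (C₁ - F f 0))) := by
  have hSx : 0 < arealSpeed f u x := arealSpeed_pos hf.continuous hmono (hC₀.trans_eq hEx.symm)
  have hSy : 0 < arealSpeed f u y :=
    arealSpeed_pos hf.continuous hmono ((hC₀.trans hC).trans_eq hEy.symm)
  have hmonoF := (strictMono_F hf.continuous hpos).monotone
  rw [transitRate_mul_div_eq hSx.ne', arealSpeed_ratio_mul_velocity_ratio hEx hEy hx hy]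
  have hx' := arealSpeed_eq hEx
  have hy' := arealSpeed_eq hEy
  have hFu : F f u < C₁ := by linarith [sq_nonneg x]
  rcases le_total 0 u with h0 | h0
  · refine mul_le_mul_of_nonneg_left ?_ (transitRate_nonneg hpos h0 (hu h0) x)
    have hareal := sub_div_sub_le_sub_div_sub hC.le (F_zero_le_F_sub hf hconv h0 (hu h0))
      (by linarith)
    have hvel := sub_div_sub_le_sub_div_sub hC.le (hmonoF h0) hFu
    have hnonneg : 0 ≤ (C₀ - (F f u - u * f u / 2)) / (C₁ - (F f u - u * f u / 2)) :=
      div_nonneg (by linarith) (by linarith)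
    gcongr
  · have hrate : transitRate f u x ≤ 0 := by
      rcases h0.eq_or_lt with rfl | h0
      · simp [transitRate]
      · exact (transitRate_neg hpos hmono h0 hSx).le
    refine mul_le_mul_of_nonpos_left ?_ hrate
    have hareal := sub_div_sub_le_sub_div_sub hC.le (F_sub_le_F_zero hf hpos hmono h0)
      (hC₀.trans hC)
    have hvel := sub_div_sub_le_sub_div_sub hC.le (hmonoF h0) (hC₀.trans hC)
    have hnonneg : 0 ≤ (C₀ - F f 0) / (C₁ - F f 0) := div_nonneg (by linarith) (by linarith)
    gcongr

end Comparison

section LengthDifference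

variable {f : ℝ → ℝ}

theorem integral_transitRate_nonpos (hf : Continuous f) (hpos : ∀ u, 0 < f u) (hmono : Monotone f)
    {C b d : ℝ} (hb : 0 ≤ b) (hbd : b ≤ d) (hdC : (C, d) ∈ curveDomain f)
    (hd : 0 ≤ curvePos f C d)
    (hg : ∀ u ∈ Ioo (curvePos f C d) (curvePos f C b), tangentIntercept f u ≤ 0) :
    ∫ w in b..d, transitRate f (curvePos f C w) w ≤ 0 := by
  rw [intervalIntegral.integral_of_le hbd, integral_Ioc_eq_integral_Ioo]
  refine setIntegral_nonpos measurableSet_Ioo fun w hw => ?_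
  have hmem : ∀ {x : ℝ}, 0 ≤ x → x ≤ d → x ∈ {w | 0 ≤ w ∧ (C, w) ∈ curveDomain f} :=
    fun h0 hx => ⟨h0, mem_curveDomain_of_abs_le hf hpos hmono hdC (abs_le_abs_of_nonneg h0 hx)⟩
  have hw0 := hb.trans hw.1.le
  have hanti := strictAntiOn_curvePos hf hpos C
  have hlow := hanti (hmem hw0 hw.2.le) (hmem (hb.trans hbd) le_rfl) hw.2
  have hhigh := hanti (hmem hb hbd) (hmem hw0 hw.2.le) hw.1
  exact transitRate_nonpos hpos (hd.trans hlow.le) (hg _ ⟨hlow, hhigh⟩) w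

theorem integral_transitRate_neg_of_curvePos_nonpos (hf : ContDiff ℝ 1 f) (hpos : ∀ u, 0 < f u)
    (hmono : Monotone f) {C p a : ℝ} (hC : F f 0 < C) (hp : 0 ≤ p) (hpa : p < a)
    (haC : (C, a) ∈ curveDomain f) (hpC : curvePos f C p ≤ 0) :
    ∫ w in p..a, transitRate f (curvePos f C w) w < 0 := by
  have habs : ∀ {x : ℝ}, 0 ≤ x → x ≤ a → |x| ≤ |a| := fun h0 hx => abs_le_abs_of_nonneg h0 hx
  have hmem : ∀ {x : ℝ}, 0 ≤ x → x ≤ a → (C, x) ∈ curveDomain f := fun h0 hx =>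
    mem_curveDomain_of_abs_le hf.continuous hpos hmono haC (habs h0 hx)
  have hint := intervalIntegrable_transitRate hf hpos hmono hC haC (habs hp hpa.le) le_rfl
  rw [← neg_pos, ← intervalIntegral.integral_neg]
  refine intervalIntegral.intervalIntegral_pos_of_pos_on hint.neg (fun w hw => neg_pos.2 ?_) hpa
  have hw0 := hp.trans hw.1.le
  have hwC := hmem hw0 hw.2.le
  exact transitRate_neg hpos hmono
    ((strictAntiOn_curvePos hf.continuous hpos C ⟨hp, hmem hp hpa.le⟩ ⟨hw0, hwC⟩ hw.1).trans_le hpC)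
    (arealSpeed_pos hf.continuous hmono (hC.trans_eq (F_curvePos hwC).symm))

theorem sub_sqrt_sq_add_sq_div_two {C₀ C₁ : ℝ} (hC : C₀ ≤ C₁) (x : ℝ) :
    C₁ - √(x ^ 2 + 2 * (C₁ - C₀)) ^ 2 / 2 = C₀ - x ^ 2 / 2 := by
  rw [Real.sq_sqrt (by linarith [sq_nonneg x])]
  ring

theorem curvePos_sqrt_sq_add {C₀ C₁ : ℝ} (hC : C₀ ≤ C₁) (x : ℝ) :
    curvePos f C₁ √(x ^ 2 + 2 * (C₁ - C₀)) = curvePos f C₀ x := by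
  rw [curvePos, sub_sqrt_sq_add_sq_div_two hC, curvePos]

theorem mem_curveDomain_sqrt_sq_add {C₀ C₁ x : ℝ} (hC : C₀ ≤ C₁)
    (hx : (C₀, x) ∈ curveDomain f) : (C₁, √(x ^ 2 + 2 * (C₁ - C₀))) ∈ curveDomain f := by
  refine mem_curveDomain_of_F_add (u := curvePos f C₀ x) ?_
  linarith [F_curvePos hx, sub_sqrt_sq_add_sq_div_two hC x]

theorem integral_transitRate_le (hf : ContDiff ℝ 1 f) (hpos : ∀ u, 0 < f u)
    (hmono : Monotone f) (hconv : ConvexOn ℝ univ f) {C₀ C₁ a : ℝ} (hC₀ : F f 0 < C₀)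
    (hC : C₀ < C₁) (ha : 0 ≤ a) (haC : (C₀, a) ∈ curveDomain f)
    (hg : 0 ≤ tangentIntercept f (curvePos f C₀ 0)) :
    ∫ w in √(2 * (C₁ - C₀))..√(a ^ 2 + 2 * (C₁ - C₀)), transitRate f (curvePos f C₁ w) w ≤
      (∫ w in (0 : ℝ)..a, transitRate f (curvePos f C₀ w) w) *
        (((C₀ - F f 0) / (C₁ - F f 0)) ^ 2 * √((C₀ - F f 0) / (C₁ - F f 0))) := by
  have hcont := hf.continuous
  have hδ : 0 < 2 * (C₁ - C₀) := by linarith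
  have hdp : √(2 * (C₁ - C₀)) ≤ √(a ^ 2 + 2 * (C₁ - C₀)) :=
    Real.sqrt_le_sqrt (le_add_of_nonneg_left (sq_nonneg a))
  have hrate₁ := continuousOn_transitRate_curvePos hf hpos hmono (hC₀.trans hC)
    (singleton_prod_uIcc_subset_curveDomain hcont hpos hmono (mem_curveDomain_sqrt_sq_add hC.le haC)
      (abs_le_abs_of_nonneg (Real.sqrt_nonneg _) hdp) le_rfl)
  rw [uIcc_of_le hdp] at hrate₁
  have hseg₀ : {C₀} ×ˢ uIcc 0 a ⊆ curveDomain f :=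
    singleton_prod_uIcc_subset_curveDomain hcont hpos hmono haC (by simp) le_rfl
  have hrate₀ := continuousOn_transitRate_curvePos hf hpos hmono hC₀ hseg₀
  have hsubst : ContinuousOn (fun x => transitRate f (curvePos f C₁ √(x ^ 2 + 2 * (C₁ - C₀)))
      √(x ^ 2 + 2 * (C₁ - C₀)) * (x / √(x ^ 2 + 2 * (C₁ - C₀)))) (Icc 0 a) :=
    (hrate₁.comp (by fun_prop) (mapsTo_sqrt_sq_add a _)).mul
      (continuous_div_sqrt_sq_add hδ).continuousOn
  rw [← uIcc_of_le ha] at hsubst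
  rw [integral_sqrt_sq_add ha hδ hrate₁, ← intervalIntegral.integral_mul_const]
  refine intervalIntegral.integral_mono_on ha hsubst.intervalIntegrable
    ((hrate₀.intervalIntegrable (μ := volume)).mul_const _) fun x hx => ?_
  have hmem : ∀ x ∈ Icc 0 a, (C₀, x) ∈ curveDomain f := fun x hx => hseg₀ ⟨rfl, uIcc_of_le ha ▸ hx⟩
  have hE := F_curvePos (mem_curveDomain_sqrt_sq_add hC.le (hmem x hx))
  rw [curvePos_sqrt_sq_add hC.le] at hE ⊢
  refine transitRate_mul_div_le (hf.differentiable one_ne_zero) hpos hmono hconv hC₀ hC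
    (F_curvePos (hmem x hx)) hE hx.1 (Real.sqrt_nonneg _) fun h0 => ?_
  have hle : curvePos f C₀ x ≤ curvePos f C₀ 0 :=
    (strictAntiOn_curvePos hcont hpos C₀).antitoneOn
      ⟨le_rfl, hmem 0 (left_mem_Icc.2 ha)⟩ ⟨hx.1, hmem x hx⟩ hx.1
  exact hg.trans (antitoneOn_tangentIntercept (hf.differentiable one_ne_zero) hconv h0
    (h0.trans hle) hle)

theorem exists_energy_integral_transitRate_nonpos (hf : ContDiff ℝ 1 f) (hpos : ∀ u, 0 < f u)
    (hmono : Monotone f) (hconv : ConvexOn ℝ univ f) {C b : ℝ} (hb : 0 < b)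
    (hbC : (C, b) ∈ curveDomain f) (hβ : 0 < curvePos f C b) :
    ∃ C₀, F f 0 < C₀ ∧ C₀ < C ∧ 0 ≤ tangentIntercept f (curvePos f C₀ 0) ∧
      b ≤ √(2 * (C - C₀)) ∧
      ∫ w in b..√(2 * (C - C₀)), transitRate f (curvePos f C w) w ≤ 0 := by
  have hcont := hf.continuous
  have hF := strictMono_F hcont hpos
  obtain ⟨ρ, ⟨hρ, hρβ⟩, hgρ, hg⟩ := exists_tangentIntercept_sign_change hf hpos hmono hconv hβ
  have hE := F_curvePos hbC
  have hρC : F f ρ < C := by linarith [hF.monotone hρβ, pow_pos hb 2]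
  have hρ₀ : curvePos f (F f ρ) 0 = ρ := curvePos_eq_of_F_add hcont hpos (by simp)
  have hEd : F f ρ + √(2 * (C - F f ρ)) ^ 2 / 2 = C := by
    rw [Real.sq_sqrt (by linarith)]
    ring
  have hd := curvePos_eq_of_F_add hcont hpos hEd
  have hbd : b ≤ √(2 * (C - F f ρ)) := Real.le_sqrt_of_sq_le (by linarith [hF.monotone hρβ])
  refine ⟨F f ρ, hF hρ, hρC, hρ₀.symm ▸ hgρ, hbd, ?_⟩
  refine integral_transitRate_nonpos hcont hpos hmono hb.le hbd (mem_curveDomain_of_F_add hEd)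
    (hρ.le.trans_eq hd.symm) fun u hu => hg u ⟨?_, hu.2.le⟩
  exact hd.symm.trans_lt hu.1

theorem sqrt_sq_add_lt_v₁ (hf : Continuous f) (hpos : ∀ u, 0 < f u) (hmono : Monotone f)
    {α lam C₀ C : ℝ} (hα : α < 0) (hlam : 0 < lam) (hC₀ : F f 0 < C₀) (hC : C₀ < C) :
    √(v₁ f α lam C₀ ^ 2 + 2 * (C - C₀)) < v₁ f α lam C := by
  have hE₀ := rayEnergy_v₁ (α := α) (lam := lam) hf hmono hC₀
  have hE := rayEnergy_v₁ (α := α) (lam := lam) hf hmono (hC₀.trans hC)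
  have hF := strictMono_F hf hpos <| mul_lt_mul_of_neg_left
    (strictMonoOn_v₁ (α := α) (lam := lam) hf hmono hC₀ (hC₀.trans hC) hC)
    (div_neg_of_pos_of_neg (Real.sqrt_pos.2 hlam) hα)
  rw [rayEnergy] at hE₀ hE
  exact (Real.sqrt_lt' (v₁_pos hf hmono (hC₀.trans hC))).2 (by linarith)

theorem integral_transitRate_sqrt_neg (hf : ContDiff ℝ 1 f) (hpos : ∀ u, 0 < f u)
    (hmono : Monotone f) (hconv : ConvexOn ℝ univ f) {α lam C₀ C : ℝ} (hα : α < 0) (hlam : 0 < lam)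
    (hC₀ : F f 0 < C₀) (hC : C₀ < C) (hg : 0 ≤ tangentIntercept f (curvePos f C₀ 0))
    (hnonpos : ∫ w in (0 : ℝ)..v₁ f α lam C₀, transitRate f (curvePos f C₀ w) w ≤ 0) :
    ∫ w in √(2 * (C - C₀))..v₁ f α lam C, transitRate f (curvePos f C w) w < 0 := by
  have hcont := hf.continuous
  have ha₀ := v₁_pos (α := α) (lam := lam) hcont hmono hC₀
  have hCF := hC₀.trans hC
  have haC := mem_curveDomain_v₁ (α := α) (lam := lam) hcont hmono hCF
  set a := v₁ f α lam C
  set p := √(v₁ f α lam C₀ ^ 2 + 2 * (C - C₀))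
  have hdp : √(2 * (C - C₀)) ≤ p := Real.sqrt_le_sqrt (le_add_of_nonneg_left (sq_nonneg _))
  have hpa : p < a := sqrt_sq_add_lt_v₁ hcont hpos hmono hα hlam hC₀ hC
  have hp : curvePos f C p ≤ 0 := by
    rw [curvePos_sqrt_sq_add hC.le, curvePos_v₁ hcont hmono hC₀ hpos]
    exact mul_nonpos_of_nonpos_of_nonneg
      (div_nonpos_of_nonneg_of_nonpos (Real.sqrt_nonneg _) hα.le) ha₀.le
  have hdp_nonpos := (integral_transitRate_le hf hpos hmono hconv hC₀ hC ha₀.le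
    (mem_curveDomain_v₁ hcont hmono hC₀) hg).trans
      (mul_nonpos_of_nonpos_of_nonneg hnonpos (by positivity))
  have hpa_neg := integral_transitRate_neg_of_curvePos_nonpos hf hpos hmono hCF
    (Real.sqrt_nonneg _) hpa haC hp
  have hpa' : |p| ≤ |a| := abs_le_abs_of_nonneg (Real.sqrt_nonneg _) hpa.le
  rw [← intervalIntegral.integral_add_adjacent_intervals
    (intervalIntegrable_transitRate hf hpos hmono hCF haC
      ((abs_le_abs_of_nonneg (Real.sqrt_nonneg _) hdp).trans hpa') hpa')
    (intervalIntegrable_transitRate hf hpos hmono hCF haC hpa' le_rfl)]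
  exact add_neg_of_nonpos_of_neg hdp_nonpos hpa_neg

theorem integral_transitRate_neg (hf : ContDiff ℝ 1 f) (hpos : ∀ u, 0 < f u)
    (hmono : Monotone f) (hconv : ConvexOn ℝ univ f) {α lam C : ℝ} (hα : α < 0) (hlam : 0 < lam)
    (hnonpos : ∀ C, F f 0 < C →
      ∫ w in (0 : ℝ)..v₁ f α lam C, transitRate f (curvePos f C w) w ≤ 0) (hC : F f 0 < C) :
    ∫ w in v₁ f (-α) lam C..v₁ f α lam C, transitRate f (curvePos f C w) w < 0 := by
  have hcont := hf.continuous
  have hb := v₁_pos (α := -α) (lam := lam) hcont hmono hC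
  have hbC := mem_curveDomain_v₁ (α := -α) (lam := lam) hcont hmono hC
  have hβ : 0 < curvePos f C (v₁ f (-α) lam C) := by
    rw [curvePos_v₁ hcont hmono hC hpos]
    exact mul_pos (div_pos (Real.sqrt_pos.2 hlam) (neg_pos.2 hα)) hb
  obtain ⟨C₀, hC₀, hC₀C, hg, hbd, hbd_nonpos⟩ :=
    exists_energy_integral_transitRate_nonpos hf hpos hmono hconv hb hbC hβ
  have hda_neg := integral_transitRate_sqrt_neg hf hpos hmono hconv hα hlam hC₀ hC₀C hg
    (hnonpos C₀ hC₀)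
  have haC := mem_curveDomain_v₁ (α := α) (lam := lam) hcont hmono hC
  have hda : √(2 * (C - C₀)) ≤ v₁ f α lam C :=
    (Real.sqrt_le_sqrt (le_add_of_nonneg_left (sq_nonneg _))).trans
      (sqrt_sq_add_lt_v₁ hcont hpos hmono hα hlam hC₀ hC₀C).le
  have hda' := abs_le_abs_of_nonneg (Real.sqrt_nonneg _) hda
  have hba' := abs_le_abs_of_nonneg hb.le (hbd.trans hda)
  rw [← intervalIntegral.integral_add_adjacent_intervals
    (intervalIntegrable_transitRate hf hpos hmono hC haC hba' hda')
    (intervalIntegrable_transitRate hf hpos hmono hC haC hda' le_rfl)]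
  exact add_neg_of_nonpos_of_neg hbd_nonpos hda_neg

theorem strictAntiOn_L₁_sub (hf : ContDiff ℝ 1 f) (hpos : ∀ u, 0 < f u) (hmono : Monotone f)
    (hconv : ConvexOn ℝ univ f) {α lam : ℝ} (hα : α < 0) (hlam : 0 < lam)
    (hanti : AntitoneOn (L₁ f α lam) (Ioi (F f 0))) :
    StrictAntiOn (fun C => L₁ f α lam C - L₁ f (-α) lam C) (Ioi (F f 0)) := by
  have hfactor : 0 < 2 / √lam := div_pos two_pos (Real.sqrt_pos.2 hlam)
  have hderiv : ∀ τ C, F f 0 < C → HasDerivAt (L₁ f τ lam) _ C :=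
    fun τ C hC => hasDerivAt_L₁ hf hpos hmono τ lam hC
  have hnonpos : ∀ C, F f 0 < C →
      ∫ w in (0 : ℝ)..v₁ f α lam C, transitRate f (curvePos f C w) w ≤ 0 := fun C hC => by
    have hC' := hanti.derivWithin_nonpos (x := C)
    rw [derivWithin_of_isOpen isOpen_Ioi hC, (hderiv α C hC).deriv] at hC'
    exact nonpos_of_mul_nonpos_right hC' hfactor
  have hsub : ∀ C, F f 0 < C → HasDerivAt (fun C => L₁ f α lam C - L₁ f (-α) lam C) _ C :=
    fun C hC => (hderiv α C hC).fun_sub (hderiv (-α) C hC)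
  refine strictAntiOn_of_deriv_neg (convex_Ioi _)
    (fun C hC => (hsub C hC).continuousAt.continuousWithinAt) fun C hC => ?_
  replace hC : F f 0 < C := interior_subset hC
  have hint : ∀ τ, IntervalIntegrable (fun w => transitRate f (curvePos f C w) w) volume
      0 (v₁ f τ lam C) := fun τ =>
    intervalIntegrable_transitRate hf hpos hmono hC
      (mem_curveDomain_v₁ hf.continuous hmono hC) (by simp) le_rfl
  rw [(hsub C hC).deriv, ← mul_sub,
    intervalIntegral.integral_interval_sub_left (hint α) (hint (-α))]
  exact mul_neg_of_pos_of_neg hfactor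
    (integral_transitRate_neg hf hpos hmono hconv hα hlam hnonpos hC)

end LengthDifference

section Trajectories

/-- `(u, v)` solves `u' = κ v`, `v' = -κ f u` on `[0, L]`, starts on the ray `u = γ v` and ends on
the ray `u = -γ v`. For `κ = √lam` and `γ = √lam / α` these are the solutions `u` of the Robin
problem, with `v = u' / √lam`. -/
structure IsTrajectory (f : ℝ → ℝ) (κ γ L : ℝ) (u v : ℝ → ℝ) : Prop where
  continuousOn_fst : ContinuousOn u (Icc 0 L)
  continuousOn_snd : ContinuousOn v (Icc 0 L)
  hasDerivAt_fst : ∀ x ∈ Ioo 0 L, HasDerivAt u (κ * v x) x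
  hasDerivAt_snd : ∀ x ∈ Ioo 0 L, HasDerivAt v (-(κ * f (u x))) x
  left : u 0 = γ * v 0
  right : u L = -γ * v L

theorem IsSolution.isTrajectory {f u : ℝ → ℝ} {α lam L : ℝ} (hα : α ≠ 0) (hlam : 0 < lam)
    (hL : 0 < L) (hu : IsSolution f α lam L u) :
    IsTrajectory f √lam (√lam / α) L u (fun x => derivWithin u (Icc 0 L) x / √lam) := by
  have hsqrt : √lam ≠ 0 := (Real.sqrt_pos.2 hlam).ne'
  have hnhds : ∀ x ∈ Ioo 0 L, Icc 0 L ∈ 𝓝 x := fun x hx => Icc_mem_nhds hx.1 hx.2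
  refine ⟨hu.contDiffOn.continuousOn, (hu.contDiffOn.continuousOn_derivWithin
    (uniqueDiffOn_Icc hL) le_rfl).div_const _, fun x hx => ?_, fun x hx => ?_, ?_, ?_⟩
  · rw [mul_div_cancel₀ _ hsqrt, derivWithin_of_mem_nhds (hnhds x hx)]
    exact ((hu.contDiffOn.differentiableOn one_ne_zero x
      (Ioo_subset_Icc_self hx)).differentiableAt (hnhds x hx)).hasDerivAt
  · have heq : (fun x => derivWithin u (Icc 0 L) x / √lam) =ᶠ[𝓝 x] fun x => deriv u x / √lam := by
      filter_upwards [isOpen_Ioo.mem_nhds hx] with y hy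
      rw [derivWithin_of_mem_nhds (hnhds y hy)]
    refine (((hu.ode x hx).div_const √lam).congr_of_eventuallyEq heq).congr_deriv ?_
    rw [neg_div, mul_div_right_comm, Real.div_sqrt]
  · simp only [hu.left]
    field_simp
  · simp only [hu.right]
    field_simp

namespace IsTrajectory

variable {f u v u' v' : ℝ → ℝ} {κ γ L : ℝ}

theorem reflect (hT : IsTrajectory f κ γ L u v) :
    IsTrajectory f κ γ L (fun x => u (L - x)) (fun x => -v (L - x)) := by
  have hIcc : MapsTo (fun x => L - x) (Icc 0 L) (Icc 0 L) := fun x hx =>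
    ⟨sub_nonneg.2 hx.2, sub_le_self L hx.1⟩
  have hIoo : ∀ x ∈ Ioo 0 L, L - x ∈ Ioo 0 L := fun x hx =>
    ⟨sub_pos.2 hx.2, sub_lt_self L hx.1⟩
  have hderiv : ∀ x : ℝ, HasDerivAt (fun x => L - x) (-1) x := fun x =>
    (hasDerivAt_id' x).const_sub L
  refine ⟨hT.continuousOn_fst.comp (by fun_prop) hIcc,
    (hT.continuousOn_snd.comp (by fun_prop) hIcc).neg, fun x hx => ?_, fun x hx => ?_, ?_, ?_⟩
  · exact ((hT.hasDerivAt_fst _ (hIoo x hx)).comp x (hderiv x)).congr_deriv (by ring)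
  · exact ((hT.hasDerivAt_snd _ (hIoo x hx)).comp x (hderiv x)).fun_neg.congr_deriv (by ring)
  · simp [hT.right]
  · simp [hT.left]

theorem F_add_eq_rayEnergy (hT : IsTrajectory f κ γ L u v) (hf : Continuous f) {x : ℝ}
    (hx : x ∈ Icc 0 L) : F f (u x) + v x ^ 2 / 2 = rayEnergy f γ (v 0) := by
  rw [rayEnergy, ← hT.left]
  refine eq_left_of_hasDerivAt_eq_zero (g := fun x => F f (u x) + v x ^ 2 / 2)
    (((continuous_F hf).comp_continuousOn hT.continuousOn_fst).add
      ((hT.continuousOn_snd.pow 2).div_const 2)) (fun x hx => ?_) hx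
  exact (((hasDerivAt_F hf (u x)).comp x (hT.hasDerivAt_fst x hx)).fun_add
    (((hT.hasDerivAt_snd x hx).fun_pow 2).div_const 2)).congr_deriv (by push_cast; ring)

theorem rayEnergy_right (hT : IsTrajectory f κ γ L u v) (hf : Continuous f) (hL : 0 ≤ L) :
    rayEnergy f (-γ) (v L) = rayEnergy f γ (v 0) := by
  rw [← hT.F_add_eq_rayEnergy hf (right_mem_Icc.2 hL), hT.right, rayEnergy]

theorem mem_curveDomain (hT : IsTrajectory f κ γ L u v) (hf : Continuous f) {x : ℝ}
    (hx : x ∈ Icc 0 L) : (rayEnergy f γ (v 0), v x) ∈ curveDomain f :=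
  mem_curveDomain_of_F_add (hT.F_add_eq_rayEnergy hf hx)

section Pos

variable (hT : IsTrajectory f κ γ L u v) (hf : Continuous f) (hpos : ∀ u, 0 < f u)

include hT hpos

theorem strictAntiOn_snd (hκ : 0 < κ) : StrictAntiOn v (Icc 0 L) := by
  refine strictAntiOn_of_deriv_neg (convex_Icc 0 L) hT.continuousOn_snd fun x hx => ?_
  rw [interior_Icc] at hx
  rw [(hT.hasDerivAt_snd x hx).deriv]
  exact neg_neg_of_pos (mul_pos hκ (hpos _))

theorem snd_zero_pos (hκ : 0 < κ) (hL : 0 < L) (hvL : 0 ≤ v L) : 0 < v 0 :=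
  hvL.trans_lt (hT.strictAntiOn_snd hpos hκ (left_mem_Icc.2 hL.le) (right_mem_Icc.2 hL.le) hL)

include hf

theorem F_zero_le_rayEnergy (hL : 0 ≤ L) (hγ : γ ≤ 0) (hvL : 0 ≤ v L) :
    F f 0 ≤ rayEnergy f γ (v 0) := by
  rw [← hT.rayEnergy_right hf hL, rayEnergy]
  have hF := (strictMono_F hf hpos).monotone (mul_nonneg (neg_nonneg.2 hγ) hvL)
  linarith [sq_nonneg (v L)]

theorem curvePos_snd {x : ℝ} (hx : x ∈ Icc 0 L) :
    curvePos f (rayEnergy f γ (v 0)) (v x) = u x :=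
  curvePos_eq_of_F_add hf hpos (hT.F_add_eq_rayEnergy hf hx)

theorem transitTime_snd (hmono : Monotone f) {x : ℝ} (hx : x ∈ Icc 0 L) :
    transitTime f (rayEnergy f γ (v 0)) (v x) =
      transitTime f (rayEnergy f γ (v 0)) (v 0) - κ * x := by
  have hderiv : ∀ y ∈ Icc 0 L,
      HasDerivAt (transitTime f (rayEnergy f γ (v 0))) (1 / f (u y)) (v y) := fun y hy =>
    hT.curvePos_snd hf hpos hy ▸ hasDerivAt_transitTime hf hpos hmono (hT.mem_curveDomain hf hy)
  have hcont : ContinuousOn (fun y => transitTime f (rayEnergy f γ (v 0)) (v y) + κ * y)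
      (Icc 0 L) := fun y hy =>
    ((hderiv y hy).continuousAt.comp_continuousWithinAt (hT.continuousOn_snd y hy)).add
      (by fun_prop)
  have hconst := eq_left_of_hasDerivAt_eq_zero hcont (fun y hy => ?_) hx
  · linarith
  · refine (((hderiv y (Ioo_subset_Icc_self hy)).comp y (hT.hasDerivAt_snd y hy)).fun_add
      ((hasDerivAt_id' y).const_mul κ)).congr_deriv ?_
    have hne := (hpos (u y)).ne'
    field_simp
    ring

theorem eqOn_of_snd_zero_eq (hmono : Monotone f) (hT' : IsTrajectory f κ γ L u' v')
    (hv : v 0 = v' 0) : EqOn u u' (Icc 0 L) := by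
  intro x hx
  have hmem' := hT'.mem_curveDomain hf hx
  have htime' := hT'.transitTime_snd hf hpos hmono hx
  rw [← hT.curvePos_snd hf hpos hx, ← hT'.curvePos_snd hf hpos hx]
  rw [← hv] at hmem' htime' ⊢
  rw [(strictMonoOn_transitTime hf hpos hmono _).injOn (hT.mem_curveDomain hf hx) hmem'
    ((hT.transitTime_snd hf hpos hmono hx).trans htime'.symm)]

theorem eqOn_of_rayEnergy_eq (hmono : Monotone f) (hκ : 0 < κ) (hγ : γ ≤ 0) (hL : 0 < L)
    (hT' : IsTrajectory f κ γ L u' v') (hvL : 0 ≤ v L) (hvL' : 0 ≤ v' L)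
    (hE : rayEnergy f γ (v 0) = rayEnergy f γ (v' 0)) : EqOn u u' (Icc 0 L) := by
  refine hT.eqOn_of_snd_zero_eq hf hpos hmono hT' ((strictMonoOn_rayEnergy hf hmono γ).injOn
    ⟨hT.snd_zero_pos hpos hκ hL hvL, ?_⟩ ⟨hT'.snd_zero_pos hpos hκ hL hvL', ?_⟩ hE)
  · exact hT.F_zero_le_rayEnergy hf hpos hL.le hγ hvL
  · exact hT'.F_zero_le_rayEnergy hf hpos hL.le hγ hvL'

end Pos

theorem L₁_sub_L₁_neg {α lam : ℝ} (hT : IsTrajectory f √lam (√lam / α) L u v) (hf : Continuous f)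
    (hpos : ∀ u, 0 < f u) (hmono : Monotone f) (hlam : 0 < lam) (hL : 0 < L) (hvL : 0 ≤ v L)
    (hE : F f 0 < rayEnergy f (√lam / α) (v 0)) :
    L₁ f α lam (rayEnergy f (√lam / α) (v 0)) - L₁ f (-α) lam (rayEnergy f (√lam / α) (v 0)) =
      2 * L := by
  have hsqrt := Real.sqrt_pos.2 hlam
  have hright := hT.rayEnergy_right hf hL.le
  rw [← div_neg] at hright
  have hvL_pos : 0 < v L := by
    refine hvL.lt_of_ne' fun h0 => hE.ne ?_
    rw [← hright, h0]
    simp [rayEnergy]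
  have hstart := v₁_rayEnergy hf hmono (hT.snd_zero_pos hpos hsqrt hL hvL) hE.le
  have hend := v₁_rayEnergy hf hmono hvL_pos (hE.le.trans_eq hright.symm)
  rw [hright] at hend
  rw [L₁_eq_transitTime, L₁_eq_transitTime, hstart, hend,
    hT.transitTime_snd hf hpos hmono (right_mem_Icc.2 hL.le)]
  field_simp
  ring

theorem eqOn {α lam : ℝ} (hf : ContDiff ℝ 1 f) (hpos : ∀ u, 0 < f u) (hmono : Monotone f)
    (hconv : ConvexOn ℝ univ f) (hα : α < 0) (hlam : 0 < lam) (hL : 0 < L)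
    (hanti : AntitoneOn (L₁ f α lam) (Ioi (F f 0)))
    (hT : IsTrajectory f √lam (√lam / α) L u v) (hvL : 0 ≤ v L)
    (hT' : IsTrajectory f √lam (√lam / α) L u' v') (hvL' : 0 ≤ v' L)
    (hiff : F f 0 = rayEnergy f (√lam / α) (v 0) ↔ F f 0 = rayEnergy f (√lam / α) (v' 0)) :
    EqOn u u' (Icc 0 L) := by
  have hcont := hf.continuous
  have hsqrt := Real.sqrt_pos.2 hlam
  have hγ := (div_neg_of_pos_of_neg hsqrt hα).le
  refine hT.eqOn_of_rayEnergy_eq hcont hpos hmono hsqrt hγ hL hT' hvL hvL' ?_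
  rcases (hT.F_zero_le_rayEnergy hcont hpos hL.le hγ hvL).eq_or_lt with hE | hE
  · exact hE.symm.trans (hiff.1 hE)
  have hE' := (hT'.F_zero_le_rayEnergy hcont hpos hL.le hγ hvL').lt_of_ne (mt hiff.2 hE.ne)
  refine (strictAntiOn_L₁_sub hf hpos hmono hconv hα hlam hanti).injOn hE hE' ?_
  exact (hT.L₁_sub_L₁_neg hcont hpos hmono hlam hL hvL hE).trans
    (hT'.L₁_sub_L₁_neg hcont hpos hmono hlam hL hvL' hE').symm

end IsTrajectory

variable {f : ℝ → ℝ} {α lam L : ℝ}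

theorem encard_domRestrict_isTrajectory_le_two (hf : ContDiff ℝ 1 f) (hpos : ∀ u, 0 < f u)
    (hmono : Monotone f) (hconv : ConvexOn ℝ univ f) (hα : α < 0) (hlam : 0 < lam) (hL : 0 < L)
    (hanti : AntitoneOn (L₁ f α lam) (Ioi (F f 0))) :
    ((Icc 0 L).domRestrict '' {u | ∃ v, IsTrajectory f √lam (√lam / α) L u v ∧ 0 ≤ v L}).encard
      ≤ 2 := by
  by_contra! hcard
  obtain ⟨t, hsub, ht⟩ := exists_subset_encard_eq (Order.add_one_le_of_lt hcard)
  obtain ⟨w₁, w₂, w₃, h₁₂, h₁₃, h₂₃, rfl⟩ := encard_eq_three.1 (ht.trans (by norm_num))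
  obtain ⟨⟨u₁, ⟨v₁, hT₁, hv₁⟩, rfl⟩, ⟨u₂, ⟨v₂, hT₂, hv₂⟩, rfl⟩, ⟨u₃, ⟨v₃, hT₃, hv₃⟩, rfl⟩⟩ := by
    simpa only [insert_subset_iff, singleton_subset_iff] using hsub
  have hne : ∀ {u u' v v' : ℝ → ℝ}, IsTrajectory f √lam (√lam / α) L u v → 0 ≤ v L →
      IsTrajectory f √lam (√lam / α) L u' v' → 0 ≤ v' L →
      (Icc 0 L).domRestrict u ≠ (Icc 0 L).domRestrict u' →
      ¬(F f 0 = rayEnergy f (√lam / α) (v 0) ↔ F f 0 = rayEnergy f (√lam / α) (v' 0)) :=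
    fun hT hv hT' hv' hu hiff => hu <| funext fun x =>
      hT.eqOn hf hpos hmono hconv hα hlam hL hanti hv hT' hv' hiff x.2
  have h₁₂ := hne hT₁ hv₁ hT₂ hv₂ h₁₂
  have h₁₃ := hne hT₁ hv₁ hT₃ hv₃ h₁₃
  have h₂₃ := hne hT₂ hv₂ hT₃ hv₃ h₂₃
  tauto

theorem solutionsOn_monotoneOn_subset (hα : α ≠ 0) (hlam : 0 < lam) (hL : 0 < L) :
    solutionsOn f α lam L (fun u => MonotoneOn u (Icc 0 L)) ⊆
      (Icc 0 L).domRestrict '' {u | ∃ v, IsTrajectory f √lam (√lam / α) L u v ∧ 0 ≤ v L} :=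
  image_mono fun _ ⟨hu, hmono⟩ => ⟨_, hu.isTrajectory hα hlam hL,
    div_nonneg hmono.derivWithin_nonneg (Real.sqrt_nonneg _)⟩

theorem encard_solutionsOn_antitoneOn_le (hα : α ≠ 0) (hlam : 0 < lam) (hL : 0 < L) :
    (solutionsOn f α lam L (fun u => AntitoneOn u (Icc 0 L))).encard ≤
      ((Icc 0 L).domRestrict ''
        {u | ∃ v, IsTrajectory f √lam (√lam / α) L u v ∧ 0 ≤ v L}).encard := by
  let reflection : Icc 0 L → Icc 0 L := fun x =>
    ⟨L - x, sub_nonneg.2 x.2.2, sub_le_self L x.2.1⟩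
  have hinj : Function.Injective fun w : Icc 0 L → ℝ => w ∘ reflection :=
    Function.Surjective.injective_comp_right fun x =>
      ⟨reflection x, Subtype.ext (sub_sub_cancel L (x : ℝ))⟩
  rw [← hinj.encard_image]
  refine encard_le_encard ?_
  rintro _ ⟨_, ⟨u, ⟨hu, hanti⟩, rfl⟩, rfl⟩
  refine ⟨_, ⟨_, (hu.isTrajectory hα hlam hL).reflect, ?_⟩, rfl⟩
  exact neg_nonneg.2 (div_nonpos_of_nonpos_of_nonneg hanti.derivWithin_nonpos (Real.sqrt_nonneg _))

end Trajectories

end RobinBVP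

end

theorem mainTheorem10_general (f : ℝ → ℝ) (α lam L : ℝ)
    (hf : Differentiable ℝ f) (hpos : ∀ u, 0 < f u) (hmono : Monotone f)
    (hconv : ConvexOn ℝ Set.univ f) (hα : α < 0) (hlam : 0 < lam) (hL : 0 < L)
    (hL₁ : AntitoneOn (RobinBVP.L₁ f α lam) (Set.Ioi (RobinBVP.s₀ f))) :
    (RobinBVP.solutionsOn f α lam L (fun u => MonotoneOn u (Set.Icc 0 L))).encard ≤ 2 ∧
    (RobinBVP.solutionsOn f α lam L (fun u => AntitoneOn u (Set.Icc 0 L))).encard ≤ 2 := by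
  have hC1 : ContDiff ℝ 1 f :=
    contDiff_one_iff_deriv.2 ⟨hf, RobinBVP.continuous_deriv_of_convexOn hf hconv⟩
  have hcard := RobinBVP.encard_domRestrict_isTrajectory_le_two hC1 hpos hmono hconv hα hlam hL hL₁
  exact ⟨(Set.encard_le_encard
    (RobinBVP.solutionsOn_monotoneOn_subset hα.ne hlam hL)).trans hcard,
    (RobinBVP.encard_solutionsOn_antitoneOn_le hα.ne hlam hL).trans hcard⟩

theorem mainTheorem10 (f : ℝ → ℝ) (α lam L : ℝ)
    (hf : Differentiable ℝ f) (hf' : Differentiable ℝ (deriv f))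
    (hpos : ∀ u, 0 < f u) (hmono : ∀ u, 0 ≤ deriv f u)
    (hsuper : Filter.Tendsto (fun u => f u / u) Filter.atTop Filter.atTop)
    (hconv : ∀ u, 0 < deriv (deriv f) u)
    (hα : α < 0) (hlam : 0 < lam) (hL : 0 < L)
    (hL₁ : StrictAntiOn (RobinBVP.L₁ f α lam) (Set.Ioi (RobinBVP.s₀ f))) :
    (RobinBVP.solutionsOn f α lam L (fun u => MonotoneOn u (Set.Icc 0 L))).encard ≤ 2 ∧
    (RobinBVP.solutionsOn f α lam L (fun u => AntitoneOn u (Set.Icc 0 L))).encard ≤ 2 := by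
  exact mainTheorem10_general f α lam L hf hpos (monotone_of_deriv_nonneg hf hmono)
    (convexOn_univ_of_deriv2_nonneg hf hf' fun u => (hconv u).le) hα hlam hL hL₁.antitoneOn
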